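/- Let $n\ge 0$, $d_1,\dots,d_n\in\mathbb N$, and let parties $A_1,\dots,A_n$ hold systems $\mathbb C^{d_1},\dots,\mathbb C^{d_n}$ with arbitrary Hermitian Hamiltonians $H_{A_1},\dots,H_{A_n}$ (energy levels may be degenerate). The global Hamiltonian is the interaction-free one, $H=\sum_{i=1}^n \mathbb I\otimes\cdots\otimes H_{A_i}\otimes\cdots\otimes\mathbb I$. Let $X_1|\cdots|X_k$ be a partition of the set of parties into $k$ nonempty blocks, let $\mathcal H_{X_b}=\bigotimes_{A_i\in X_b}\mathbb C^{d_i}$, and let $H_{X_b}$ be the sum of the Hamiltonians of the parties in $X_b$, regarded as an operator on $\mathcal H_{X_b}$. For a unit vector $|\psi\rangle\in\bigotimes_{i=1}^n\mathbb C^{d_i}$ put $\psi=|\psi\rangle\langle\psi|$ and $$W_e^{g}(\psi)=\operatorname{Tr}(\psi H)-\min_{U}\operatorname{Tr}(U\psi U^\dagger H),\qquad W_e^{X_1|\cdots|X_k}(\psi)=\operatorname{Tr}(\psi H)-\min_{U_1,\dots,U_k}\operatorname{Tr}\big((U_1\otimes\cdots\otimes U_k)\,\psi\,(U_1\otimes\cdots\otimes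 U_k)^\dagger H\big),$$ where $U$ runs over all unitaries of the whole system and $U_b$ over all unitaries of $\mathcal H_{X_b}$. The $k$-separable ergotropic gap is $\Delta^{(k)}_{X_1|\cdots|X_k}(\psi)=W_e^{g}(\psi)-W_e^{X_1|\cdots|X_k}(\psi)$. (a) The gap is non-increasing under LOCC: if $|\psi\rangle$ and $|\phi\rangle$ are unit vectors in $\bigotimes_{i=1}^n\mathbb C^{d_i}$ and $|\psi\rangle$ can be transformed deterministically into $|\phi\rangle$ by a finite protocol of local operations of the $n$ parties and classical communication between them, then $$\Delta^{(k)}_{X_1|\cdots|X_k}(\phi)\le\Delta^{(k)}_{X_1|\cdots|X_k}(\psi).$$ (b) If in addition the lowest eigenvalue of every $H_{A_i}$ is $0$, then for every unit vector $|\psi\rangle$ $$\Delta^{(k)}_{X_1|\cdots|X_k}(\psi)=\sum_{b=1}^k\operatorname{Tr}\big(\rho_{X_b}^{p}H_{X_b}\big),$$ where $\rho_{X_b}$ is the marginal of $\psi$ on $X_b$ and $\rho_{X_b}^{p}=\sum_j\lambda_j|\epsilon_j\rangle\langle\epsilon_j|$ is its passive state: $\lambda_0\ge\lambda_1\ge\cdots$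 are the eigenvalues of $\rho_{X_b}$ and $(|\epsilon_j\rangle)_j$ is an orthonormal eigenbasis of $H_{X_b}$ with energies $e_0\le e_1\le\cdots$. -/

import Mathlib

open scoped Matrix ComplexConjugate

noncomputable section

namespace Ergo

/-- Labels of the product basis of `⨂ i, ℂ^(d i)`. -/
abbrev Idx {ι : Type} (d : ι → ℕ) : Type := ∀ i, Fin (d i)

/-- The Hilbert space `⨂ i, ℂ^(d i)`, written in the product basis. -/
abbrev Hilb {ι : Type} [Fintype ι] [DecidableEq ι] (d : ι → ℕ) : Type :=
  EuclideanSpace ℂ (Idx d)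

/-- Operators on `⨂ i, ℂ^(d i)`, as matrices in the product basis. -/
abbrev Op {ι : Type} (d : ι → ℕ) : Type := Matrix (Idx d) (Idx d) ℂ

/-- The rank-one projector `|ψ⟩⟨ψ|`. -/
def pureState {I : Type} [Fintype I] (ψ : EuclideanSpace ℂ I) : Matrix I I ℂ :=
  Matrix.of fun x y => ψ x * conj (ψ y)

/-- The tensor product `⨂ i, K i` of operators `K i : ℂ^(d i) → ℂ^(d' i)`. -/
def tensorOp {ι : Type} [Fintype ι] {d d' : ι → ℕ}
    (K : ∀ i, Matrix (Fin (d' i)) (Fin (d i)) ℂ) : Matrix (Idx d') (Idx d) ℂ :=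
  Matrix.of fun x y => ∏ i, K i (x i) (y i)

/-! ### LOCC -/

/-- `IsLOCC d Φ`: the map `Φ`, from operators on `⨂ i, ℂ^(d i)` to operators on `⨂ i, ℂ^(d' i)`,
is realised by a finite protocol of local operations and classical communication between the
parties `i : Fin n`. In every round each party `i` performs a measurement with finitely many
outcomes `a i` and Kraus operators `K i (a i)` on its own system (trivial measurements, unitaries,
adding and discarding ancillas, and randomisation are special cases; the dimension of the system
after the measurement may depend on the outcome). All outcomes are broadcast, and the rest of the
protocol may depend on them. Forgetting outcomes is the case in which the rest does not depend on
them; the outcomes are summed over in `Φ`. -/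
inductive IsLOCC {n : ℕ} {d' : Fin n → ℕ} : (d : Fin n → ℕ) → (Op d → Op d') → Prop
  | done : IsLOCC d' (fun ρ => ρ)
  | round (d : Fin n → ℕ) (r : Fin n → ℕ) (m : ∀ i, Fin (r i) → ℕ)
      (K : ∀ i (a : Fin (r i)), Matrix (Fin (m i a)) (Fin (d i)) ℂ)
      (hK : ∀ i, ∑ a, (K i a)ᴴ * K i a = 1)
      (Φ : ∀ a : (∀ i, Fin (r i)), Op (fun i => m i (a i)) → Op d')
      (hΦ : ∀ a, IsLOCC (fun i => m i (a i)) (Φ a)) :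
      IsLOCC d (fun ρ => ∑ a : (∀ i, Fin (r i)),
        Φ a (tensorOp (fun i => K i (a i)) * ρ * (tensorOp (fun i => K i (a i)))ᴴ))

/-- The pure state `ψ` can be transformed deterministically into the pure state `φ` by LOCC. -/
def LOCCConvertible {n : ℕ} {d : Fin n → ℕ} (ψ φ : Hilb d) : Prop :=
  ∃ Φ : Op d → Op d, IsLOCC d Φ ∧ Φ (pureState ψ) = pureState φ

/-! ### Hamiltonians, blocks of a partition, marginals -/

/-- The interaction-free Hamiltonian `∑ i, 1 ⊗ ⋯ ⊗ H i ⊗ ⋯ ⊗ 1`. -/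
def freeHamiltonian {ι : Type} [Fintype ι] [DecidableEq ι] {d : ι → ℕ}
    (H : ∀ i, Matrix (Fin (d i)) (Fin (d i)) ℂ) : Op d :=
  ∑ i, tensorOp (Function.update (fun j => (1 : Matrix (Fin (d j)) (Fin (d j)) ℂ)) i (H i))

/-- The local dimensions of the parties in the block `b` of the partition that is given by
`X : Fin n → Fin k`; this block consists of the parties `i` with `X i = b`. -/
abbrev blockDim {n k : ℕ} (d : Fin n → ℕ) (X : Fin n → Fin k) (b : Fin k) :
    {i : Fin n // X i = b} → ℕ :=
  fun i => d i

/-- The Hamiltonian of a block: the sum of the Hamiltonians of its parties. -/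
def blockHamiltonian {n k : ℕ} {d : Fin n → ℕ} (H : ∀ i, Matrix (Fin (d i)) (Fin (d i)) ℂ)
    (X : Fin n → Fin k) (b : Fin k) : Op (blockDim d X b) :=
  freeHamiltonian (d := blockDim d X b) (fun i => H i)

/-- The marginal of `ρ` on the block `b`: the partial trace over the parties outside `b`. -/
def marginal {n k : ℕ} {d : Fin n → ℕ} (X : Fin n → Fin k) (b : Fin k) (ρ : Op d) :
    Op (blockDim d X b) :=
  Matrix.of fun x y => ∑ z : (∀ i : {i : Fin n // ¬ X i = b}, Fin (d i)),
    ρ ((Equiv.piEquivPiSubtypeProd (fun i => X i = b) (fun i => Fin (d i))).symm (x, z))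
      ((Equiv.piEquivPiSubtypeProd (fun i => X i = b) (fun i => Fin (d i))).symm (y, z))

/-- The operator `⨂ b, U b` on the whole system, where `U b` acts on the block `b`. -/
def blockTensor {n k : ℕ} {d : Fin n → ℕ} (X : Fin n → Fin k)
    (U : ∀ b, Op (blockDim d X b)) : Op d :=
  Matrix.of fun x y => ∏ b, U b (fun i => x i) (fun i => y i)

/-! ### Energy, ergotropy, the ergotropic gap -/

/-- The energy `Tr (ρ H)` (a real number when `ρ` and `H` are Hermitian). -/
def energy {I : Type} [Fintype I] (H ρ : Matrix I I ℂ) : ℝ := (ρ * H).trace.re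

/-- Unitary groups are compact, so the minima in the definition of ergotropy below are attained. -/
theorem compactSpace_unitaryGroup (I : Type) [Fintype I] [DecidableEq I] :
    CompactSpace (Matrix.unitaryGroup I ℂ) := by
  refine (isCompact_iff_compactSpace (s := (Matrix.unitaryGroup I ℂ : Set (Matrix I I ℂ)))).mp ?_
  refine IsCompact.of_isClosed_subset
    (isCompact_univ_pi fun _ : I => isCompact_univ_pi fun _ : I =>
      isCompact_closedBall (0 : ℂ) 1) (isClosed_unitary (R := Matrix I I ℂ)) fun U hU => ?_
  exact fun i _ j _ => mem_closedBall_zero_iff.mpr (entry_norm_bound_of_unitary hU i j)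

theorem continuous_energy_conj {I T : Type} [Fintype I] [TopologicalSpace T] (H ρ : Matrix I I ℂ)
    {f : T → Matrix I I ℂ} (hf : Continuous f) :
    Continuous fun t => energy H (f t * ρ * (f t)ᴴ) := by
  unfold energy
  exact Complex.continuous_re.comp
    (((hf.matrix_mul continuous_const).matrix_mul hf.matrix_conjTranspose).matrix_mul
      continuous_const).matrix_trace

/-- The minimum over all unitaries is attained. -/
theorem exists_min_global {n : ℕ} {d : Fin n → ℕ} (H ρ : Op d) :
    ∃ U : Matrix.unitaryGroup (Idx d) ℂ,
      IsLeast (Set.range fun V : Matrix.unitaryGroup (Idx d) ℂ =>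
        energy H ((V : Op d) * ρ * (V : Op d)ᴴ)) (energy H ((U : Op d) * ρ * (U : Op d)ᴴ)) := by
  have := compactSpace_unitaryGroup (Idx d)
  obtain ⟨U, -, hU⟩ := isCompact_univ.exists_isMinOn
    (Set.univ_nonempty (α := Matrix.unitaryGroup (Idx d) ℂ))
    (continuous_energy_conj H ρ continuous_subtype_val).continuousOn
  refine ⟨U, ⟨U, rfl⟩, ?_⟩
  rintro _ ⟨V, rfl⟩
  exact hU (Set.mem_univ V)

/-- The minimum over all block-local unitaries is attained. -/
theorem exists_min_block {n k : ℕ} {d : Fin n → ℕ} (X : Fin n → Fin k) (H ρ : Op d) :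
    ∃ U : (∀ b, Matrix.unitaryGroup (Idx (blockDim d X b)) ℂ),
      IsLeast (Set.range fun V : (∀ b, Matrix.unitaryGroup (Idx (blockDim d X b)) ℂ) =>
        energy H (blockTensor X (fun b => (V b : Op (blockDim d X b))) * ρ *
          (blockTensor X (fun b => (V b : Op (blockDim d X b))))ᴴ))
        (energy H (blockTensor X (fun b => (U b : Op (blockDim d X b))) * ρ *
          (blockTensor X (fun b => (U b : Op (blockDim d X b))))ᴴ)) := by
  have := fun b => compactSpace_unitaryGroup (Idx (blockDim d X b))
  have hf : Continuous fun V : (∀ b, Matrix.unitaryGroup (Idx (blockDim d X b)) ℂ) =>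
      blockTensor X (fun b => (V b : Op (blockDim d X b))) := by
    refine continuous_matrix fun x y => ?_
    simp only [blockTensor, Matrix.of_apply]
    exact continuous_finsetProd _ fun b _ =>
      (continuous_subtype_val.comp (continuous_apply b)).matrix_elem _ _
  obtain ⟨U, -, hU⟩ := isCompact_univ.exists_isMinOn
    (Set.univ_nonempty (α := ∀ b, Matrix.unitaryGroup (Idx (blockDim d X b)) ℂ))
    (continuous_energy_conj H ρ hf).continuousOn
  refine ⟨U, ⟨U, rfl⟩, ?_⟩
  rintro _ ⟨V, rfl⟩
  exact hU (Set.mem_univ V)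

/-- Global ergotropy: `Tr (ρ H) - min_U Tr (U ρ Uᴴ H)` over all unitaries of the whole system.
(The infimum is a minimum.) -/
def globalErgotropy {n : ℕ} {d : Fin n → ℕ} (H : ∀ i, Matrix (Fin (d i)) (Fin (d i)) ℂ)
    (ρ : Op d) : ℝ :=
  energy (freeHamiltonian H) ρ -
    ⨅ U : Matrix.unitaryGroup (Idx d) ℂ,
      energy (freeHamiltonian H) ((U : Op d) * ρ * (U : Op d)ᴴ)

/-- Block-local ergotropy: the same with unitaries `⨂ b, U b` that act blockwise. -/
def blockErgotropy {n k : ℕ} {d : Fin n → ℕ} (H : ∀ i, Matrix (Fin (d i)) (Fin (d i)) ℂ)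
    (X : Fin n → Fin k) (ρ : Op d) : ℝ :=
  energy (freeHamiltonian H) ρ -
    ⨅ U : (∀ b, Matrix.unitaryGroup (Idx (blockDim d X b)) ℂ),
      energy (freeHamiltonian H)
        (blockTensor X (fun b => (U b : Op (blockDim d X b))) * ρ *
          (blockTensor X (fun b => (U b : Op (blockDim d X b))))ᴴ)

/-- The `k`-separable ergotropic gap of the pure state `ψ` for the partition `X`. -/
def ergotropicGap {n k : ℕ} {d : Fin n → ℕ} (H : ∀ i, Matrix (Fin (d i)) (Fin (d i)) ℂ)
    (X : Fin n → Fin k) (ψ : Hilb d) : ℝ :=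
  globalErgotropy H (pureState ψ) - blockErgotropy H X (pureState ψ)

/-! ### Passive states -/

/-- The `j`-th vector of an orthonormal eigenbasis of `H`, for the `j`-th of the eigenvalues
`hH.eigenvalues₀`, which are listed in (weakly) decreasing order with multiplicity. -/
def eigvec {I : Type} [Fintype I] [DecidableEq I] {H : Matrix I I ℂ} (hH : H.IsHermitian)
    (j : Fin (Fintype.card I)) : EuclideanSpace ℂ I :=
  hH.eigenvectorBasis (Fintype.equivOfCardEq (Fintype.card_fin _) j)

/-- `H (eigvec j) = (j-th eigenvalue) • eigvec j`. -/
theorem mulVec_eigvec {I : Type} [Fintype I] [DecidableEq I] {H : Matrix I I ℂ}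
    (hH : H.IsHermitian) (j : Fin (Fintype.card I)) :
    H *ᵥ (eigvec hH j).ofLp = hH.eigenvalues₀ j • (eigvec hH j).ofLp := by
  have h := hH.mulVec_eigenvectorBasis (Fintype.equivOfCardEq (Fintype.card_fin _) j)
  simpa [eigvec, Matrix.IsHermitian.eigenvalues] using h

/-- The passive state `∑ j, λ_j |ε_j⟩⟨ε_j|` of `ρ` with respect to the Hamiltonian `H`: the
eigenvalues `λ_j` of `ρ` in weakly decreasing order sit on eigenvectors `ε_j` of `H` whose energies
are in weakly increasing order. -/
def passiveState {I : Type} [Fintype I] [DecidableEq I] {ρ H : Matrix I I ℂ}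
    (hρ : ρ.IsHermitian) (hH : H.IsHermitian) : Matrix I I ℂ :=
  ∑ j : Fin (Fintype.card I), (hρ.eigenvalues₀ j : ℂ) • pureState (eigvec hH j.rev)

theorem isHermitian_freeHamiltonian {ι : Type} [Fintype ι] [DecidableEq ι] {d : ι → ℕ}
    {H : ∀ i, Matrix (Fin (d i)) (Fin (d i)) ℂ} (hH : ∀ i, (H i).IsHermitian) :
    (freeHamiltonian H).IsHermitian := by
  unfold freeHamiltonian
  refine Matrix.isHermitian_iff_isSelfAdjoint.mpr (isSelfAdjoint_sum _ fun i _ => ?_)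
  refine Matrix.isHermitian_iff_isSelfAdjoint.mp (Matrix.IsHermitian.ext fun x y => ?_)
  simp only [tensorOp, Matrix.of_apply, star_prod]
  refine Finset.prod_congr rfl fun j _ => ?_
  rcases eq_or_ne j i with rfl | hj
  · simpa using (hH j).apply (x j) (y j)
  · simpa [Function.update_of_ne hj] using
      (Matrix.isHermitian_one (n := Fin (d j)) (α := ℂ)).apply (x j) (y j)

theorem isHermitian_blockHamiltonian {n k : ℕ} {d : Fin n → ℕ}
    {H : ∀ i, Matrix (Fin (d i)) (Fin (d i)) ℂ} (hH : ∀ i, (H i).IsHermitian)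
    (X : Fin n → Fin k) (b : Fin k) : (blockHamiltonian H X b).IsHermitian :=
  isHermitian_freeHamiltonian (d := blockDim d X b) fun i => hH i

theorem isHermitian_marginal {n k : ℕ} {d : Fin n → ℕ} (X : Fin n → Fin k) (b : Fin k)
    (ψ : Hilb d) : (marginal X b (pureState ψ)).IsHermitian := by
  refine Matrix.IsHermitian.ext fun x y => ?_
  simp only [marginal, Matrix.of_apply, star_sum]
  refine Finset.sum_congr rfl fun z _ => ?_
  simp only [pureState, Matrix.of_apply, star_mul', RCLike.star_def, Complex.conj_conj]
  exact mul_comm _ _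

/-- The passive energy `Tr (ρ_b^p H_b)` of the marginal of `ψ` on the block `b`. -/
def passiveEnergy {n k : ℕ} {d : Fin n → ℕ} {H : ∀ i, Matrix (Fin (d i)) (Fin (d i)) ℂ}
    (hH : ∀ i, (H i).IsHermitian) (X : Fin n → Fin k) (b : Fin k) (ψ : Hilb d) : ℝ :=
  energy (blockHamiltonian H X b)
    (passiveState (isHermitian_marginal X b ψ) (isHermitian_blockHamiltonian hH X b))

end Ergo

end

/-!
The energy of a state without interaction between the blocks is the sum of the energies of its
marginals (`Ergo.energy_blockTensor_conj`), so the minimum over block-local unitaries splits into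
one minimization per block. Within the unitary orbit of a density matrix the passive state has the
least energy: this is the rearrangement inequality, extended from permutations to doubly stochastic
matrices by Birkhoff's theorem (`Ergo.isLeast_energy_passiveState`). The block-local minimum is
therefore `∑ b, passiveEnergy hH X b ψ`. The global minimum is the same for all unit vectors,
because the unitary group acts transitively on them, and it vanishes if all local ground-state
energies do. The gap is the difference of the two minima, which gives the formula in terms of
passive states.

For monotonicity under LOCC it remains to see that the passive energy of every block does not
increase, which by summation by parts follows once the spectrum of the marginal of `ψ` is majorized
by that of `φ` (`Ergo.LOCCConvertible.partialSum_le`). Only separability of the protocol matters: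
it has Kraus operators `K t` that are tensor products, and since the output is pure,
`K t ψ = c t • φ` with `∑ t, ‖c t‖ ^ 2 = 1`. The sum `S_j` of the `j` largest eigenvalues of a
marginal is the maximal squared overlap of the vector with a unit vector of Schmidt rank at most
`j`. If `χ` has Schmidt rank at most `j`, then so has every `K t χ`, whence
`|⟨χ, ψ⟩| = |∑ t, c t ⟨K t χ, φ⟩| ≤ √(S_j φ) (∑ t, ‖K t χ‖ ^ 2)^(1/2) = √(S_j φ) ‖χ‖`
by the Cauchy–Schwarz inequality. Taking for `χ` the truncation of `ψ` to its `j` largest Schmidt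
coefficients gives `S_j ψ ≤ S_j φ`.
-/

open scoped Matrix ComplexConjugate

noncomputable section

namespace Ergo

/-! ### Tensor products of local operators -/

theorem tensorOp_mul {ι : Type} [Fintype ι] [DecidableEq ι] {d d' d'' : ι → ℕ}
    (L : ∀ i, Matrix (Fin (d'' i)) (Fin (d' i)) ℂ) (K : ∀ i, Matrix (Fin (d' i)) (Fin (d i)) ℂ) :
    tensorOp L * tensorOp K = tensorOp fun i => L i * K i := by
  ext x y
  simp only [tensorOp, Matrix.mul_apply, Matrix.of_apply, Fintype.prod_sum,
    Finset.prod_mul_distrib]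

theorem conjTranspose_tensorOp {ι : Type} [Fintype ι] {d d' : ι → ℕ}
    (K : ∀ i, Matrix (Fin (d' i)) (Fin (d i)) ℂ) :
    (tensorOp K)ᴴ = tensorOp fun i => (K i)ᴴ := by
  ext x y
  simp [tensorOp, Matrix.conjTranspose_apply]

theorem tensorOp_one {ι : Type} [Fintype ι] [DecidableEq ι] (d : ι → ℕ) :
    tensorOp (fun i => (1 : Matrix (Fin (d i)) (Fin (d i)) ℂ)) = 1 := by
  ext x y
  simp only [tensorOp, Matrix.of_apply, Matrix.one_apply, Finset.prod_ite_zero, funext_iff]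
  simp

theorem tensorOp_mulVec_prod {ι : Type} [Fintype ι] [DecidableEq ι] {d d' : ι → ℕ}
    (K : ∀ i, Matrix (Fin (d' i)) (Fin (d i)) ℂ) (v : ∀ i, Fin (d i) → ℂ) :
    tensorOp K *ᵥ (fun x => ∏ i, v i (x i)) = fun x => ∏ i, (K i *ᵥ v i) (x i) := by
  ext x
  simp only [tensorOp, Matrix.mulVec, dotProduct, Matrix.of_apply, Fintype.prod_sum,
    Finset.prod_mul_distrib]

theorem sum_tensorOp {ι : Type} [Fintype ι] [DecidableEq ι] {d d' : ι → ℕ} {r : ι → ℕ}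
    (K : ∀ i, Fin (r i) → Matrix (Fin (d' i)) (Fin (d i)) ℂ) :
    ∑ a : (∀ i, Fin (r i)), tensorOp (fun i => K i (a i)) = tensorOp fun i => ∑ a, K i a := by
  ext x y
  simp only [tensorOp, Matrix.sum_apply, Matrix.of_apply, Fintype.prod_sum]

/-! ### Operators that factorize over the blocks -/

section Blocks

variable {n k : ℕ} {d : Fin n → ℕ} (X : Fin n → Fin k)

/-- A label of the product basis, cut into its restrictions to the blocks. -/
def blockEquiv (d : Fin n → ℕ) : Idx d ≃ ∀ b, Idx (blockDim d X b) where
  toFun x _ i := x i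
  invFun f i := f (X i) ⟨i, rfl⟩
  left_inv _ := rfl
  right_inv f := by
    funext b ⟨i, hi⟩
    subst hi
    rfl

theorem blockTensor_mul (U V : ∀ b, Op (blockDim d X b)) :
    blockTensor X U * blockTensor X V = blockTensor X fun b => U b * V b := by
  ext x y
  simp only [blockTensor, Matrix.mul_apply, Matrix.of_apply, Fintype.prod_sum,
    ← Finset.prod_mul_distrib]
  exact Fintype.sum_equiv (blockEquiv X d) _ _ fun z => rfl

theorem conjTranspose_blockTensor (U : ∀ b, Op (blockDim d X b)) :
    (blockTensor X U)ᴴ = blockTensor X fun b => (U b)ᴴ := by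
  ext x y
  simp [blockTensor, Matrix.conjTranspose_apply]

theorem tensorOp_eq_blockTensor (K : ∀ i, Matrix (Fin (d i)) (Fin (d i)) ℂ) :
    tensorOp K = blockTensor X fun b => tensorOp (d := blockDim d X b) fun i => K i := by
  ext x y
  simp only [tensorOp, blockTensor, Matrix.of_apply]
  exact (Fintype.prod_fiberwise X fun i => K i (x i) (y i)).symm

/-- The operator that acts as `A` on the block `b` and trivially on the other parties. -/
def blockEmbed (b : Fin k) (A : Op (blockDim d X b)) : Op d :=
  blockTensor X (Function.update (fun _ => 1) b A)

theorem blockEmbed_apply (b : Fin k) (A : Op (blockDim d X b)) (x y : Idx d) :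
    blockEmbed X b A x y = A (fun i => x i) (fun i => y i) *
      if ∀ i, X i ≠ b → x i = y i then 1 else 0 := by
  simp only [blockEmbed, blockTensor, Matrix.of_apply]
  rw [← Finset.mul_prod_erase _ _ (Finset.mem_univ b), Function.update_self]
  congr 1
  have h : ∀ b' ∈ Finset.univ.erase b,
      (Function.update (fun _ => 1) b A : ∀ b, Op (blockDim d X b)) b' (fun i => x i)
        (fun i => y i) = if ∀ i : {i // X i = b'}, x i = y i then 1 else 0 := by
    intro b' hb'
    rw [Function.update_of_ne (Finset.ne_of_mem_erase hb'), Matrix.one_apply]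
    simp only [funext_iff]
  rw [Finset.prod_congr rfl h, Finset.prod_ite_zero]
  simp only [Finset.prod_const_one, Finset.mem_erase, Finset.mem_univ, and_true, Subtype.forall]
  refine if_congr ⟨fun h i hi => h _ hi i rfl, fun h b' hb' i hi => h i (hi ▸ hb')⟩ rfl rfl

theorem blockTensor_conj_blockEmbed (U : ∀ b, Op (blockDim d X b)) (hU : ∀ b, (U b)ᴴ * U b = 1)
    (b : Fin k) (A : Op (blockDim d X b)) :
    (blockTensor X U)ᴴ * blockEmbed X b A * blockTensor X U =
      blockEmbed X b ((U b)ᴴ * A * U b) := by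
  rw [conjTranspose_blockTensor, blockEmbed, blockTensor_mul, blockTensor_mul, blockEmbed]
  congr 1
  funext b'
  rcases eq_or_ne b' b with rfl | h
  · simp
  · simp [Function.update_of_ne h, hU]

theorem trace_mul_blockEmbed (b : Fin k) (A : Op (blockDim d X b)) (ρ : Op d) :
    (ρ * blockEmbed X b A).trace = (marginal X b ρ * A).trace := by
  simp only [Matrix.trace, Matrix.diag_apply, Matrix.mul_apply, marginal, Matrix.of_apply,
    blockEmbed_apply]
  set e := Equiv.piEquivPiSubtypeProd (fun i => X i = b) (fun i => Fin (d i)) with he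
  have h1 : ∀ (p : Idx (blockDim d X b)) (z : ∀ i : {i : Fin n // ¬ X i = b}, Fin (d i)),
      (fun i : {i // X i = b} => e.symm (p, z) i) = p := by
    intro p z
    funext i
    simp [he, Equiv.piEquivPiSubtypeProd, i.2]
  have h2 : ∀ (p q : Idx (blockDim d X b)) (z w : ∀ i : {i : Fin n // ¬ X i = b}, Fin (d i)),
      (∀ i, X i ≠ b → e.symm (p, z) i = e.symm (q, w) i) ↔ w = z := by
    intro p q z w
    constructor
    · intro h
      funext i
      have := h i i.2
      simpa [he, Equiv.piEquivPiSubtypeProd, i.2] using this.symm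
    · rintro rfl i hi
      simp [he, Equiv.piEquivPiSubtypeProd, hi]
  rw [← e.symm.sum_comp, Fintype.sum_prod_type]
  refine Finset.sum_congr rfl fun p _ => ?_
  simp_rw [← e.symm.sum_comp (fun y => ρ _ y * _), Fintype.sum_prod_type, h1, h2]
  rw [Finset.sum_comm]
  refine Finset.sum_congr rfl fun q _ => ?_
  simp [Finset.sum_mul]

theorem freeHamiltonian_eq_sum_blockEmbed (H : ∀ i, Matrix (Fin (d i)) (Fin (d i)) ℂ) :
    freeHamiltonian H = ∑ b, blockEmbed X b (blockHamiltonian H X b) := by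
  have h0 : ∀ b, blockEmbed X b (blockHamiltonian H X b) = ∑ i : {i // X i = b},
      tensorOp (Function.update (fun j => (1 : Matrix (Fin (d j)) (Fin (d j)) ℂ)) i (H i)) := by
    intro b
    have : ∀ i : {i // X i = b},
        tensorOp (Function.update (fun j => (1 : Matrix (Fin (d j)) (Fin (d j)) ℂ)) i (H i)) =
        blockEmbed X b (tensorOp (Function.update
          (fun j : {i // X i = b} => (1 : Matrix (Fin (d j)) (Fin (d j)) ℂ)) i (H i))) := by
      intro i
      rw [tensorOp_eq_blockTensor X, blockEmbed]
      congr 1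
      funext b'
      rcases eq_or_ne b' b with rfl | h
      · rw [Function.update_self]
        congr 1
        funext j
        rcases eq_or_ne j i with rfl | hj
        · simp
        · rw [Function.update_of_ne hj, Function.update_of_ne fun h => hj (Subtype.ext h)]
      · rw [Function.update_of_ne h, ← tensorOp_one]
        congr 1
        funext j
        refine Function.update_of_ne (fun hj => h ?_) _ _
        rw [← j.2, hj, i.2]
    simp_rw [this]
    ext x y
    simp only [blockHamiltonian, freeHamiltonian, blockEmbed_apply, Matrix.sum_apply,
      Finset.sum_mul]
  simp_rw [h0]
  exact (Fintype.sum_fiberwise X _).symm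

/-- The free Hamiltonian has no interaction between the blocks, so after a block-local unitary the
energy is the sum of the energies of the transformed marginals. -/
theorem energy_blockTensor_conj (H : ∀ i, Matrix (Fin (d i)) (Fin (d i)) ℂ)
    (U : ∀ b, Op (blockDim d X b)) (hU : ∀ b, (U b)ᴴ * U b = 1) (ρ : Op d) :
    energy (freeHamiltonian H) (blockTensor X U * ρ * (blockTensor X U)ᴴ) =
      ∑ b, energy (blockHamiltonian H X b) (U b * marginal X b ρ * (U b)ᴴ) := by
  simp only [energy, ← Complex.re_sum]
  congr 1
  rw [freeHamiltonian_eq_sum_blockEmbed X, Finset.mul_sum, Matrix.trace_sum]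
  refine Finset.sum_congr rfl fun b _ => ?_
  rw [Matrix.mul_assoc, Matrix.mul_assoc, Matrix.trace_mul_comm, Matrix.mul_assoc,
    Matrix.mul_assoc, ← Matrix.mul_assoc _ (blockEmbed X b _), blockTensor_conj_blockEmbed X U hU,
    trace_mul_blockEmbed, Matrix.mul_assoc (U b), Matrix.mul_assoc (U b),
    Matrix.trace_mul_comm (U b)]
  simp only [Matrix.mul_assoc]

end Blocks

/-! ### Pure states and unitary matrices -/

theorem inner_toLp_mulVec {I J : Type} [Fintype I] [Fintype J] (A : Matrix I J ℂ)
    (x : EuclideanSpace ℂ J) (y : EuclideanSpace ℂ I) :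
    inner ℂ y (WithLp.toLp 2 (A *ᵥ x.ofLp)) = inner ℂ (WithLp.toLp 2 (Aᴴ *ᵥ y.ofLp)) x := by
  simp only [EuclideanSpace.inner_eq_star_dotProduct, Matrix.star_mulVec,
    Matrix.conjTranspose_conjTranspose]
  rw [dotProduct_comm, Matrix.dotProduct_mulVec, dotProduct_comm]

theorem norm_toLp_mulVec {I J : Type} [Fintype I] [Fintype J] [DecidableEq J] {A : Matrix I J ℂ}
    (hA : Aᴴ * A = 1) (x : EuclideanSpace ℂ J) : ‖WithLp.toLp 2 (A *ᵥ x.ofLp)‖ = ‖x‖ := by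
  have h := inner_toLp_mulVec A x (WithLp.toLp 2 (A *ᵥ x.ofLp))
  simp only [Matrix.mulVec_mulVec, hA, Matrix.one_mulVec, WithLp.toLp_ofLp,
    inner_self_eq_norm_sq_to_K] at h
  norm_cast at h
  exact (sq_eq_sq₀ (norm_nonneg _) (norm_nonneg _)).mp h

theorem conj_pureState {I J : Type} [Fintype I] [Fintype J] (A : Matrix I J ℂ)
    (x : EuclideanSpace ℂ J) :
    A * pureState x * Aᴴ = pureState (WithLp.toLp 2 (A *ᵥ x.ofLp)) := by
  have h : ∀ {K : Type} [Fintype K] (z : EuclideanSpace ℂ K),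
      pureState z = Matrix.vecMulVec z.ofLp (star z.ofLp) := fun z => rfl
  rw [h, h, Matrix.mul_vecMulVec, Matrix.vecMulVec_mul, Matrix.star_mulVec]

theorem trace_pureState_mul_pureState {I : Type} [Fintype I] (x y : EuclideanSpace ℂ I) :
    (pureState x * pureState y).trace = (‖inner ℂ y x‖ ^ 2 : ℝ) := by
  rw [← Complex.normSq_eq_norm_sq, ← Complex.mul_conj, inner_conj_symm]
  simp only [Matrix.trace, Matrix.diag_apply, Matrix.mul_apply, pureState, Matrix.of_apply,
    EuclideanSpace.inner_eq_star_dotProduct, dotProduct, Finset.sum_mul_sum, Pi.star_apply,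
    RCLike.star_def]
  refine Finset.sum_congr rfl fun i _ => Finset.sum_congr rfl fun j _ => by ring

theorem exists_unitary_mulVec_eq {I J : Type} [Fintype I] [DecidableEq I] [Fintype J]
    (u w : OrthonormalBasis J ℂ (EuclideanSpace ℂ I)) :
    ∃ U : Matrix.unitaryGroup I ℂ,
      ∀ j, WithLp.toLp 2 ((U : Matrix I I ℂ) *ᵥ (u j).ofLp) = w j := by
  set f := Unitary.linearIsometryEquiv.symm (u.equiv w (Equiv.refl J)) with hf
  obtain ⟨U, hU⟩ : ∃ U : Matrix I I ℂ, Matrix.toEuclideanCLM (n := I) (𝕜 := ℂ) U = f.1 :=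
    (Matrix.toEuclideanCLM (n := I) (𝕜 := ℂ)).surjective f.1
  have hU' : U ∈ Matrix.unitaryGroup I ℂ := by
    refine Matrix.mem_unitaryGroup_iff'.mpr
      ((Matrix.toEuclideanCLM (n := I) (𝕜 := ℂ)).injective ?_)
    change Matrix.toEuclideanCLM (n := I) (𝕜 := ℂ) _ = Matrix.toEuclideanCLM (n := I) (𝕜 := ℂ) _
    rw [map_mul, map_star, hU, map_one]
    exact (Unitary.mem_iff.mp f.2).1
  refine ⟨⟨U, hU'⟩, fun j => ?_⟩
  change Matrix.toEuclideanCLM (n := I) (𝕜 := ℂ) U (u j) = w j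
  rw [hU, hf, Unitary.coe_symm_linearIsometryEquiv_apply]
  simp

/-- The unitary group acts transitively on the unit sphere. -/
theorem exists_unitary_mulVec_eq_of_norm {I : Type} [Fintype I] [DecidableEq I]
    {x y : EuclideanSpace ℂ I} (hx : ‖x‖ = 1) (hy : ‖y‖ = 1) :
    ∃ U : Matrix.unitaryGroup I ℂ, WithLp.toLp 2 ((U : Matrix I I ℂ) *ᵥ x.ofLp) = y := by
  have hI : Nonempty I := by
    by_contra h
    have : IsEmpty I := not_nonempty_iff.mp h
    rw [Subsingleton.elim x 0, norm_zero] at hx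
    exact zero_ne_one hx
  obtain ⟨i⟩ := hI
  have ext : ∀ z : EuclideanSpace ℂ I, ‖z‖ = 1 →
      ∃ b : OrthonormalBasis I ℂ (EuclideanSpace ℂ I), b i = z := by
    intro z hz
    have ho : Orthonormal ℂ (({i} : Set I).domRestrict fun _ : I => z) := by
      refine ⟨fun _ => hz, fun a b hab => (hab (Subsingleton.elim a b)).elim⟩
    obtain ⟨b, hb⟩ := ho.exists_orthonormalBasis_extension_of_card_eq (by simp)
    exact ⟨b, hb i rfl⟩
  obtain ⟨u, rfl⟩ := ext x hx
  obtain ⟨w, rfl⟩ := ext y hy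
  obtain ⟨U, hU⟩ := exists_unitary_mulVec_eq u w
  exact ⟨U, hU i⟩

/-! ### Passive states minimize the energy -/

section Passive

variable {I : Type} [Fintype I] [DecidableEq I] {A : Matrix I I ℂ} (hA : A.IsHermitian)

/-- The vectors `eigvec hA j` as an orthonormal basis. -/
def eigvecBasis : OrthonormalBasis (Fin (Fintype.card I)) ℂ (EuclideanSpace ℂ I) :=
  hA.eigenvectorBasis.reindex (Fintype.equivOfCardEq (Fintype.card_fin _)).symm

theorem eigvecBasis_apply (j : Fin (Fintype.card I)) : eigvecBasis hA j = eigvec hA j := by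
  simp [eigvecBasis, eigvec]

theorem sum_eigenvalues₀_smul_pureState :
    A = ∑ j, (hA.eigenvalues₀ j : ℂ) • pureState (eigvec hA j) := by
  ext x y
  conv_lhs => rw [hA.spectral_theorem, Unitary.conjStarAlgAut_apply]
  rw [Matrix.mul_apply, ← (Fintype.equivOfCardEq (Fintype.card_fin _)).sum_comp,
    Matrix.sum_apply]
  refine Finset.sum_congr rfl fun j _ => ?_
  simp only [Matrix.mul_diagonal, Matrix.smul_apply, pureState, eigvec, Matrix.of_apply,
    Matrix.star_apply, Matrix.IsHermitian.eigenvectorUnitary_apply, Function.comp_apply,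
    Matrix.IsHermitian.eigenvalues, Equiv.symm_apply_apply, smul_eq_mul, RCLike.star_def,
    Complex.coe_algebraMap]
  ring

theorem energy_pureState (χ : EuclideanSpace ℂ I) :
    energy A (pureState χ) = ∑ j, hA.eigenvalues₀ j * ‖inner ℂ (eigvec hA j) χ‖ ^ 2 := by
  conv_lhs => rw [sum_eigenvalues₀_smul_pureState hA]
  simp only [energy, Matrix.mul_sum, Matrix.trace_sum, Matrix.mul_smul, Matrix.trace_smul,
    trace_pureState_mul_pureState, smul_eq_mul, ← Complex.ofReal_mul, ← Complex.ofReal_sum,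
    Complex.ofReal_re]

theorem energy_sum_smul {J : Type} [Fintype J] (H : Matrix I I ℂ) (c : J → ℝ)
    (ρ : J → Matrix I I ℂ) :
    energy H (∑ j, (c j : ℂ) • ρ j) = ∑ j, c j * energy H (ρ j) := by
  simp [energy, Finset.sum_mul, Matrix.trace_sum, Complex.re_sum]

/-- By Birkhoff's theorem, the rearrangement inequality extends from permutations to doubly
stochastic matrices. -/
theorem sum_mul_rev_le_sum_mul_mul {N : ℕ} {l e : Fin N → ℝ} (hl : Antitone l) (he : Antitone e)
    {M : Matrix (Fin N) (Fin N) ℝ} (hM : M ∈ doublyStochastic ℝ (Fin N)) :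
    ∑ i, l i * e i.rev ≤ ∑ i, l i * ∑ j, e j * M i j := by
  obtain ⟨c, hc0, hc1, rfl⟩ := exists_eq_sum_perm_of_mem_doublyStochastic hM
  have h1 : ∀ σ : Equiv.Perm (Fin N), ∑ i, l i * e i.rev ≤ ∑ i, l i * e (σ i) := by
    intro σ
    have hv : Antivary l fun i => e i.rev := by
      refine Antitone.antivary hl fun i j hij => he (Fin.rev_le_rev.mpr hij)
    have := hv.sum_mul_le_sum_mul_comp_perm (σ := σ.trans Fin.revPerm)
    simpa using this
  calc ∑ i, l i * e i.rev = ∑ σ, c σ * ∑ i, l i * e i.rev := by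
        rw [← Finset.sum_mul, hc1, one_mul]
    _ ≤ ∑ σ, c σ * ∑ i, l i * e (σ i) :=
        Finset.sum_le_sum fun σ _ => mul_le_mul_of_nonneg_left (h1 σ) (hc0 σ)
    _ = _ := by
        simp only [Matrix.sum_apply, Matrix.smul_apply, smul_eq_mul, PEquiv.toMatrix_apply,
          Equiv.toPEquiv_apply, Option.mem_def, Option.some.injEq, Finset.mul_sum]
        rw [Finset.sum_comm]
        refine Finset.sum_congr rfl fun i _ => ?_
        rw [Finset.sum_comm]
        refine Finset.sum_congr rfl fun σ _ => ?_
        simp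
        ring

theorem energy_passiveState {ρ : Matrix I I ℂ} (hρ : ρ.IsHermitian) :
    energy A (passiveState hρ hA) = ∑ j, hρ.eigenvalues₀ j * hA.eigenvalues₀ j.rev := by
  rw [passiveState, energy_sum_smul]
  refine Finset.sum_congr rfl fun j _ => ?_
  rw [energy_pureState hA]
  simp only [← eigvecBasis_apply]
  rw [Finset.sum_eq_single j.rev (fun i _ hi => by simp [hi])
    (by simp)]
  simp

theorem norm_sq_inner_mem_doublyStochastic {J : Type} [Fintype J] [DecidableEq J]
    (U : Matrix.unitaryGroup I ℂ) (u w : OrthonormalBasis J ℂ (EuclideanSpace ℂ I)) :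
    (Matrix.of fun i j => ‖inner ℂ (w j) (WithLp.toLp 2 ((U : Matrix I I ℂ) *ᵥ (u i).ofLp))‖ ^ 2) ∈
      doublyStochastic ℝ J := by
  have hU1 : (U : Matrix I I ℂ)ᴴ * (U : Matrix I I ℂ) = 1 :=
    Matrix.mem_unitaryGroup_iff'.mp U.2
  have hU2 : (U : Matrix I I ℂ)ᴴᴴ * (U : Matrix I I ℂ)ᴴ = 1 := by
    rw [Matrix.conjTranspose_conjTranspose]
    exact Matrix.mem_unitaryGroup_iff.mp U.2
  rw [mem_doublyStochastic_iff_sum]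
  refine ⟨fun i j => sq_nonneg _, fun i => ?_, fun j => ?_⟩
  · simp only [Matrix.of_apply]
    rw [OrthonormalBasis.sum_sq_norm_inner_right, norm_toLp_mulVec hU1]
    simp
  · have h : ∀ i, inner ℂ (w j) (WithLp.toLp 2 ((U : Matrix I I ℂ) *ᵥ (u i).ofLp)) =
        inner ℂ (WithLp.toLp 2 ((U : Matrix I I ℂ)ᴴ *ᵥ (w j).ofLp)) (u i) :=
      fun i => inner_toLp_mulVec _ _ _
    simp only [Matrix.of_apply, h]
    rw [OrthonormalBasis.sum_sq_norm_inner_left, norm_toLp_mulVec hU2]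
    simp

/-- The passive state has the least energy in the unitary orbit of `ρ`. -/
theorem isLeast_energy_passiveState {ρ : Matrix I I ℂ} (hρ : ρ.IsHermitian) :
    IsLeast (Set.range fun U : Matrix.unitaryGroup I ℂ =>
      energy A ((U : Matrix I I ℂ) * ρ * (U : Matrix I I ℂ)ᴴ))
      (energy A (passiveState hρ hA)) := by
  have key : ∀ U : Matrix.unitaryGroup I ℂ,
      energy A ((U : Matrix I I ℂ) * ρ * (U : Matrix I I ℂ)ᴴ) =
        ∑ i, hρ.eigenvalues₀ i *
          energy A (pureState (WithLp.toLp 2 ((U : Matrix I I ℂ) *ᵥ (eigvec hρ i).ofLp))) := by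
    intro U
    conv_lhs => rw [sum_eigenvalues₀_smul_pureState hρ]
    simp only [Matrix.mul_sum, Matrix.sum_mul, Matrix.mul_smul, Matrix.smul_mul, conj_pureState,
      energy_sum_smul]
  constructor
  · obtain ⟨U, hU⟩ := exists_unitary_mulVec_eq (eigvecBasis hρ)
      ((eigvecBasis hA).reindex Fin.revPerm)
    refine ⟨U, ?_⟩
    beta_reduce
    rw [key, passiveState, energy_sum_smul]
    refine Finset.sum_congr rfl fun i _ => ?_
    rw [← eigvecBasis_apply, hU, OrthonormalBasis.reindex_apply, eigvecBasis_apply]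
    rfl
  · rintro _ ⟨U, rfl⟩
    beta_reduce
    rw [key, energy_passiveState]
    simp only [energy_pureState hA, ← eigvecBasis_apply]
    exact sum_mul_rev_le_sum_mul_mul hρ.eigenvalues₀_antitone hA.eigenvalues₀_antitone
      (norm_sq_inner_mem_doublyStochastic U (eigvecBasis hρ) (eigvecBasis hA))

end Passive

/-! ### Kraus operators of LOCC maps -/

/-- An LOCC map is separable: it has Kraus operators that are tensor products of local ones. This
is all that is used about LOCC; the dimensions at intermediate stages no longer appear. -/
theorem IsLOCC.exists_kraus {n : ℕ} {d d' : Fin n → ℕ} {Φ : Op d → Op d'} (h : IsLOCC d Φ) :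
    ∃ (T : Type) (_ : Fintype T) (K : T → ∀ i, Matrix (Fin (d' i)) (Fin (d i)) ℂ),
      ∑ t, (tensorOp (K t))ᴴ * tensorOp (K t) = 1 ∧
        ∀ ρ, Φ ρ = ∑ t, tensorOp (K t) * ρ * (tensorOp (K t))ᴴ := by
  induction h with
  | done =>
    exact ⟨Unit, inferInstance, fun _ _ => 1, by simp [tensorOp_one], by simp [tensorOp_one]⟩
  | round d r m K hK Φ hΦ ih =>
    choose T hT L hL1 hL2 using ih
    refine ⟨Σ a, T a, inferInstance, fun t i => L t.1 t.2 i * K i (t.1 i), ?_, fun ρ => ?_⟩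
    · have h1 : ∀ a, ∑ t : T a, (tensorOp fun i => L a t i * K i (a i))ᴴ *
          (tensorOp fun i => L a t i * K i (a i)) = tensorOp fun i => (K i (a i))ᴴ * K i (a i) := by
        intro a
        simp only [← tensorOp_mul, Matrix.conjTranspose_mul]
        have h2 : ∀ t : T a, (tensorOp fun i => K i (a i))ᴴ * (tensorOp (L a t))ᴴ *
            (tensorOp (L a t) * tensorOp fun i => K i (a i)) = (tensorOp fun i => K i (a i))ᴴ *
            ((tensorOp (L a t))ᴴ * tensorOp (L a t)) * tensorOp fun i => K i (a i) := fun t => by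
          simp only [Matrix.mul_assoc]
        simp only [h2]
        rw [← Matrix.sum_mul, ← Matrix.mul_sum, hL1 a, Matrix.mul_one, conjTranspose_tensorOp]
      rw [Fintype.sum_sigma]
      simp only [h1]
      rw [sum_tensorOp fun i a => (K i a)ᴴ * K i a]
      simp only [hK, tensorOp_one]
    · rw [Fintype.sum_sigma]
      refine Finset.sum_congr rfl fun a _ => ?_
      rw [hL2]
      refine Finset.sum_congr rfl fun t _ => ?_
      simp only [← tensorOp_mul, Matrix.conjTranspose_mul, Matrix.mul_assoc]

/-- A pure state is not a nontrivial mixture. -/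
theorem exists_smul_eq_of_sum_pureState {I T : Type} [Fintype I] [Fintype T]
    {v : T → EuclideanSpace ℂ I} {φ : EuclideanSpace ℂ I} (hφ : ‖φ‖ = 1)
    (h : ∑ t, pureState (v t) = pureState φ) :
    ∃ c : T → ℂ, ∑ t, ‖c t‖ ^ 2 = 1 ∧ ∀ t, v t = c t • φ := by
  have hsum : ∀ y : EuclideanSpace ℂ I, ∑ t, ‖inner ℂ y (v t)‖ ^ 2 = ‖inner ℂ y φ‖ ^ 2 := by
    intro y
    have := congrArg (fun ρ => (ρ * pureState y).trace) h
    simp only [Finset.sum_mul, Matrix.trace_sum, trace_pureState_mul_pureState] at this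
    exact_mod_cast this
  have hφφ : inner ℂ φ φ = (1 : ℂ) := by simp [inner_self_eq_norm_sq_to_K, hφ]
  refine ⟨fun t => inner ℂ φ (v t), by simp [hsum, hφ], fun t => ?_⟩
  -- The component `y` of `v t` orthogonal to `φ` is seen by none of the terms of the mixture.
  set y := v t - (inner ℂ φ (v t) : ℂ) • φ with hy
  have hyφ : inner ℂ y φ = (0 : ℂ) := by
    rw [hy, inner_sub_left, inner_smul_left, inner_conj_symm, hφφ, mul_one, sub_self]
  have h0 := hsum y
  rw [hyφ, norm_zero, zero_pow two_ne_zero,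
    Finset.sum_eq_zero_iff_of_nonneg fun _ _ => sq_nonneg _] at h0
  have h1 : inner ℂ y (v t) = (0 : ℂ) := by simpa using h0 t (Finset.mem_univ t)
  have h2 : inner ℂ y y = (0 : ℂ) := by
    conv_lhs => rw [hy, inner_sub_right, inner_smul_right, ← hy, hyφ, h1]
    simp
  exact sub_eq_zero.mp (inner_self_eq_zero.mp h2)

/-- If the Kraus operators `K t` all send `ψ` to multiples of `φ`, then the overlap of `χ` with `ψ`
is controlled by the overlaps of the vectors `K t χ` with `φ`. -/
theorem norm_inner_sq_le_of_kraus {I J T : Type} [Fintype I] [DecidableEq I] [Fintype J]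
    [Fintype T] {K : T → Matrix J I ℂ} (hK : ∑ t, (K t)ᴴ * K t = 1) {c : T → ℂ}
    (hc : ∑ t, ‖c t‖ ^ 2 = 1) {ψ χ : EuclideanSpace ℂ I} {φ : EuclideanSpace ℂ J}
    (hψ : ∀ t, WithLp.toLp 2 (K t *ᵥ ψ.ofLp) = c t • φ) {S : ℝ}
    (hS : ∀ t, ‖inner ℂ (WithLp.toLp 2 (K t *ᵥ χ.ofLp)) φ‖ ^ 2 ≤
      S * ‖WithLp.toLp 2 (K t *ᵥ χ.ofLp)‖ ^ 2) :
    ‖inner ℂ χ ψ‖ ^ 2 ≤ S * ‖χ‖ ^ 2 := by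
  have hin : ∀ x y : EuclideanSpace ℂ I, ∑ t, inner ℂ (WithLp.toLp 2 (K t *ᵥ x.ofLp))
      (WithLp.toLp 2 (K t *ᵥ y.ofLp)) = inner ℂ x y := by
    intro x y
    simp only [EuclideanSpace.inner_eq_star_dotProduct, Matrix.star_mulVec]
    simp only [dotProduct_comm (K _ *ᵥ _), ← Matrix.dotProduct_mulVec, Matrix.mulVec_mulVec]
    rw [← dotProduct_sum, ← Matrix.sum_mulVec, hK, Matrix.one_mulVec, dotProduct_comm]
  have hnorm : ∑ t, ‖WithLp.toLp 2 (K t *ᵥ χ.ofLp)‖ ^ 2 = ‖χ‖ ^ 2 := by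
    have := hin χ χ
    simp only [inner_self_eq_norm_sq_to_K] at this
    exact_mod_cast this
  calc ‖inner ℂ χ ψ‖ ^ 2
      = ‖∑ t, c t * inner ℂ (WithLp.toLp 2 (K t *ᵥ χ.ofLp)) φ‖ ^ 2 := by
        rw [← hin]
        simp only [hψ, inner_smul_right]
    _ ≤ (∑ t, ‖c t‖ * ‖inner ℂ (WithLp.toLp 2 (K t *ᵥ χ.ofLp)) φ‖) ^ 2 := by
        gcongr
        exact (norm_sum_le _ _).trans_eq (by simp only [norm_mul])
    _ ≤ (∑ t, ‖c t‖ ^ 2) * ∑ t, ‖inner ℂ (WithLp.toLp 2 (K t *ᵥ χ.ofLp)) φ‖ ^ 2 :=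
        Finset.sum_mul_sq_le_sq_mul_sq _ _ _
    _ ≤ 1 * ∑ t, S * ‖WithLp.toLp 2 (K t *ᵥ χ.ofLp)‖ ^ 2 := by
        rw [hc]
        gcongr with t
        exact hS t
    _ = S * ‖χ‖ ^ 2 := by rw [one_mul, ← Finset.mul_sum, hnorm]

/-! ### Weighted sums of ordered sequences -/

/-- The sum of the first `j` terms of a finite sequence. -/
def partialSum {N : ℕ} (l : Fin N → ℝ) (j : ℕ) : ℝ := ∑ i, if i.val < j then l i else 0

/-- Weights in `[0, 1]` of total mass at most `j` collect the most from a decreasing sequence when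
they sit on its first `j` terms. -/
theorem sum_mul_le_partialSum {N : ℕ} {l t : Fin N → ℝ} (hl : Antitone l) (hl0 : ∀ i, 0 ≤ l i)
    (ht0 : ∀ i, 0 ≤ t i) (ht1 : ∀ i, t i ≤ 1) {j : ℕ} (ht : ∑ i, t i ≤ j) :
    ∑ i, l i * t i ≤ partialSum l j := by
  rcases le_or_gt N j with hj | hj
  · refine Finset.sum_le_sum fun i _ => ?_
    rw [if_pos (i.2.trans_le hj)]
    exact mul_le_of_le_one_right (hl0 i) (ht1 i)
  · -- Compare every term with the threshold value `m`, the first one left out of the sum.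
    set m := l ⟨j, hj⟩ with hm
    have h1 : ∀ i, l i * t i ≤ (if i.val < j then l i else 0) +
        m * (t i - if i.val < j then 1 else 0) := by
      intro i
      split_ifs with hi
      · have : m ≤ l i := hl (Fin.mk_le_mk.mpr hi.le)
        nlinarith [ht1 i]
      · have : l i ≤ m := hl (Fin.mk_le_mk.mpr (not_lt.mp hi))
        nlinarith [ht0 i]
    have h2 : ∑ i : Fin N, (if i.val < j then (1 : ℝ) else 0) = j := by
      rw [Finset.sum_boole]
      congr 1
      rw [Fin.card_filter_val_lt, min_eq_right hj.le]
    calc ∑ i, l i * t i ≤ ∑ i, ((if i.val < j then l i else 0) +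
          m * (t i - if i.val < j then 1 else 0)) := Finset.sum_le_sum fun i _ => h1 i
      _ = partialSum l j + m * (∑ i, t i - j) := by
          rw [Finset.sum_add_distrib, ← Finset.mul_sum, Finset.sum_sub_distrib, h2, partialSum]
      _ ≤ partialSum l j := by
          nlinarith [hl0 ⟨j, hj⟩]

/-- Summation by parts in the form of an inequality. The bound `G`, which the total `∑ i, δ i`
multiplies, is arbitrary so that the induction can use it with the last value of `g`. -/
theorem sum_mul_le_sum_mul_of_partialSum_nonpos {N : ℕ} {δ g : Fin N → ℝ} (hg : Monotone g)
    (hδ : ∀ j, partialSum δ j ≤ 0) {G : ℝ} (hG : ∀ i, g i ≤ G) :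
    (∑ i, δ i) * G ≤ ∑ i, δ i * g i := by
  induction N generalizing G with
  | zero => simp
  | succ N ih =>
    have hδ' : ∀ j, partialSum (fun i : Fin N => δ i.castSucc) j ≤ 0 := by
      intro j
      -- Cutting at `N` keeps the last term out of the partial sum.
      have := hδ (min j N)
      rw [partialSum, Fin.sum_univ_castSucc] at this
      simpa [partialSum] using this
    have h1 := ih (g := fun i => g i.castSucc)
      (fun i j hij => hg (Fin.castSucc_le_castSucc_iff.mpr hij)) hδ'
      (G := g (Fin.last N)) (fun i => hg (Fin.le_last _))
    have h2 : ∑ i, δ i ≤ 0 := by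
      have := hδ (N + 1)
      simpa only [partialSum, Fin.is_lt, if_true] using this
    rw [Fin.sum_univ_castSucc] at h2
    rw [Fin.sum_univ_castSucc, Fin.sum_univ_castSucc]
    nlinarith [hG (Fin.last N)]

theorem sum_mul_le_sum_mul_of_majorized {N : ℕ} {l m g : Fin N → ℝ} (hg : Monotone g)
    (h : ∀ j, partialSum l j ≤ partialSum m j) (hsum : ∑ i, l i = ∑ i, m i) :
    ∑ i, m i * g i ≤ ∑ i, l i * g i := by
  have h1 : ∀ j, partialSum (fun i => l i - m i) j ≤ 0 := by
    intro j
    have : partialSum (fun i => l i - m i) j = partialSum l j - partialSum m j := by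
      simp only [partialSum, ← Finset.sum_sub_distrib]
      refine Finset.sum_congr rfl fun i _ => ?_
      split_ifs <;> simp
    rw [this]
    linarith [h j]
  obtain ⟨G, hG⟩ : ∃ G, ∀ i, g i ≤ G := by
    obtain ⟨G, hG⟩ := (Set.finite_range g).bddAbove
    exact ⟨G, fun i => hG ⟨i, rfl⟩⟩
  have h2 := sum_mul_le_sum_mul_of_partialSum_nonpos hg h1 hG
  simp only [Finset.sum_sub_distrib, sub_mul, hsum, sub_self] at h2
  linarith

/-! ### Schmidt rank and the spectrum of a marginal -/

section Schmidt

variable {n k : ℕ} {d : Fin n → ℕ} (X : Fin n → Fin k) (b : Fin k)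

/-- The vector on the block `b` that remains of `χ` when the labels of the parties outside `b` are
fixed to `z`. These are the columns of the matrix of `χ` for the cut between `b` and the rest. -/
def slice (χ : Hilb d) (z : ∀ i : {i : Fin n // ¬ X i = b}, Fin (d i)) :
    Hilb (blockDim d X b) :=
  WithLp.toLp 2 fun x =>
    χ ((Equiv.piEquivPiSubtypeProd (fun i => X i = b) (fun i => Fin (d i))).symm (x, z))

theorem inner_eq_sum_slice (χ φ : Hilb d) :
    inner ℂ χ φ = ∑ z, inner ℂ (slice X b χ z) (slice X b φ z) := by
  simp only [PiLp.inner_apply, slice]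
  rw [← (Equiv.piEquivPiSubtypeProd (fun i => X i = b) (fun i => Fin (d i))).symm.sum_comp,
    Fintype.sum_prod_type, Finset.sum_comm]

theorem norm_sq_eq_sum_slice (χ : Hilb d) : ‖χ‖ ^ 2 = ∑ z, ‖slice X b χ z‖ ^ 2 := by
  have := inner_eq_sum_slice X b χ χ
  simp only [inner_self_eq_norm_sq_to_K] at this
  exact_mod_cast this

theorem marginal_pureState (ψ : Hilb d) :
    marginal X b (pureState ψ) = ∑ z, pureState (slice X b ψ z) := by
  ext x y
  simp [marginal, pureState, slice, Matrix.sum_apply]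

theorem energy_marginal_pureState (ψ : Hilb d) (w : Hilb (blockDim d X b)) :
    energy (marginal X b (pureState ψ)) (pureState w) =
      ∑ z, ‖inner ℂ w (slice X b ψ z)‖ ^ 2 := by
  rw [energy, marginal_pureState, Matrix.trace_mul_comm, Finset.sum_mul, Matrix.trace_sum]
  simp only [trace_pureState_mul_pureState, ← Complex.ofReal_sum, Complex.ofReal_re]

theorem eigenvalues₀_marginal (ψ : Hilb d) (j : Fin (Fintype.card (Idx (blockDim d X b)))) :
    (isHermitian_marginal X b ψ).eigenvalues₀ j =
      ∑ z, ‖inner ℂ (eigvec (isHermitian_marginal X b ψ) j) (slice X b ψ z)‖ ^ 2 := by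
  rw [← energy_marginal_pureState, energy_pureState (isHermitian_marginal X b ψ)]
  simp only [← eigvecBasis_apply]
  rw [Finset.sum_eq_single j (fun i _ hi => by simp [hi]) (by simp)]
  simp

theorem eigenvalues₀_marginal_nonneg (ψ : Hilb d)
    (j : Fin (Fintype.card (Idx (blockDim d X b)))) :
    0 ≤ (isHermitian_marginal X b ψ).eigenvalues₀ j := by
  rw [eigenvalues₀_marginal]
  positivity

theorem sum_eigenvalues₀_marginal (ψ : Hilb d) :
    ∑ j, (isHermitian_marginal X b ψ).eigenvalues₀ j = ‖ψ‖ ^ 2 := by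
  simp only [eigenvalues₀_marginal, ← eigvecBasis_apply]
  rw [Finset.sum_comm, norm_sq_eq_sum_slice X b]
  simp only [OrthonormalBasis.sum_sq_norm_inner_right]

/-- The Schmidt rank of `χ` for the cut between the block `b` and the rest is at most `j`. -/
def SchmidtRankLE (j : ℕ) (χ : Hilb d) : Prop :=
  ∃ W : Submodule ℂ (Hilb (blockDim d X b)), Module.finrank ℂ W ≤ j ∧ ∀ z, slice X b χ z ∈ W

variable {X b}

theorem SchmidtRankLE.tensorOp {j : ℕ} {χ : Hilb d} (hχ : SchmidtRankLE X b j χ)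
    (K : ∀ i, Matrix (Fin (d i)) (Fin (d i)) ℂ) :
    SchmidtRankLE X b j (WithLp.toLp 2 (tensorOp K *ᵥ χ.ofLp) : Hilb d) := by
  obtain ⟨W, hW, hχW⟩ := hχ
  set A : Op (blockDim d X b) := Ergo.tensorOp fun i => K i with hA
  refine ⟨W.map (Matrix.toEuclideanLin A), (Submodule.finrank_map_le _ _).trans hW, fun z => ?_⟩
  -- With `χ` as a matrix, `A ⊗ B` acts as `χ ↦ A χ Bᵀ`: the columns of the result are combinations
  -- of the images under `A` of the columns of `χ`.
  have : slice X b (WithLp.toLp 2 (Ergo.tensorOp K *ᵥ χ.ofLp) : Hilb d) z =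
      ∑ z', (∏ i : {i : Fin n // ¬ X i = b}, K i (z i) (z' i)) •
        Matrix.toEuclideanLin A (slice X b χ z') := by
    ext x
    simp only [slice, Matrix.mulVec, dotProduct, WithLp.ofLp_sum, Finset.sum_apply,
      WithLp.ofLp_smul, Pi.smul_apply, Matrix.toLpLin_apply, smul_eq_mul, Finset.mul_sum]
    rw [← (Equiv.piEquivPiSubtypeProd (fun i => X i = b) (fun i => Fin (d i))).symm.sum_comp,
      Fintype.sum_prod_type, Finset.sum_comm]
    refine Finset.sum_congr rfl fun z' _ => Finset.sum_congr rfl fun x' _ => ?_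
    rw [← mul_assoc]
    congr 1
    simp only [Ergo.tensorOp, Matrix.of_apply, hA]
    rw [← Fintype.prod_subtype_mul_prod_subtype (fun i => X i = b), mul_comm]
    congr 1
    · refine Finset.prod_congr rfl fun i _ => ?_
      simp [Equiv.piEquivPiSubtypeProd, i.2]
    · refine Finset.prod_congr rfl fun i _ => ?_
      simp [Equiv.piEquivPiSubtypeProd, i.2]
  rw [this]
  exact Submodule.sum_mem _ fun z' _ => Submodule.smul_mem _ _
    (Submodule.mem_map_of_mem (hχW z'))

/-- Ky Fan's maximum principle for the Schmidt coefficients, upper bound. -/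
theorem SchmidtRankLE.norm_inner_sq_le {j : ℕ} {χ : Hilb d} (hχ : SchmidtRankLE X b j χ)
    (φ : Hilb d) :
    ‖inner ℂ χ φ‖ ^ 2 ≤ partialSum (isHermitian_marginal X b φ).eigenvalues₀ j * ‖χ‖ ^ 2 := by
  obtain ⟨W, hW, hχW⟩ := hχ
  set hφ := isHermitian_marginal X b φ with hφ_def
  let w := stdOrthonormalBasis ℂ W
  have hw : Orthonormal ℂ fun m => (w m : Hilb (blockDim d X b)) :=
    w.orthonormal.comp_linearIsometry W.subtypeₗᵢ
  have h1 : ∀ z, ‖inner ℂ (slice X b χ z) (slice X b φ z)‖ ≤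
      ‖slice X b χ z‖ * ‖W.orthogonalProjectionOnto (slice X b φ z)‖ := by
    intro z
    rw [← Submodule.inner_orthogonalProjectionOnto_eq_of_mem_left ⟨_, hχW z⟩]
    exact norm_inner_le_norm _ _
  have h2 : ∑ z, ‖W.orthogonalProjectionOnto (slice X b φ z)‖ ^ 2 ≤
      partialSum hφ.eigenvalues₀ j := by
    calc ∑ z, ‖W.orthogonalProjectionOnto (slice X b φ z)‖ ^ 2
        = ∑ z, ∑ m, ‖inner ℂ (w m : Hilb (blockDim d X b)) (slice X b φ z)‖ ^ 2 := by
          refine Finset.sum_congr rfl fun z _ => ?_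
          rw [← w.sum_sq_norm_inner_right]
          simp only [Submodule.inner_orthogonalProjectionOnto_eq_of_mem_left]
      _ = ∑ i, hφ.eigenvalues₀ i *
            ∑ m, ‖inner ℂ (eigvec hφ i) (w m : Hilb (blockDim d X b))‖ ^ 2 := by
          rw [Finset.sum_comm]
          simp only [← energy_marginal_pureState, energy_pureState hφ, Finset.mul_sum]
          exact Finset.sum_comm
      _ ≤ partialSum hφ.eigenvalues₀ j := by
          refine sum_mul_le_partialSum hφ.eigenvalues₀_antitone
            (eigenvalues₀_marginal_nonneg X b φ) (fun i => by positivity) (fun i => ?_) ?_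
          -- Each weight is at most `1` by Bessel's inequality, and the weights add up to `dim W`.
          · simp only [norm_inner_symm (eigvec hφ i)]
            refine (hw.sum_inner_products_le _).trans_eq ?_
            rw [← eigvecBasis_apply]
            simp
          · rw [Finset.sum_comm]
            simp only [← eigvecBasis_apply, OrthonormalBasis.sum_sq_norm_inner_right, hw.1]
            simpa using hW
  calc ‖inner ℂ χ φ‖ ^ 2
      ≤ (∑ z, ‖slice X b χ z‖ * ‖W.orthogonalProjectionOnto (slice X b φ z)‖) ^ 2 := by
        rw [inner_eq_sum_slice X b]
        gcongr
        exact (norm_sum_le _ _).trans (Finset.sum_le_sum fun z _ => h1 z)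
    _ ≤ (∑ z, ‖slice X b χ z‖ ^ 2) * ∑ z, ‖W.orthogonalProjectionOnto (slice X b φ z)‖ ^ 2 :=
        Finset.sum_mul_sq_le_sq_mul_sq _ _ _
    _ ≤ ‖χ‖ ^ 2 * partialSum hφ.eigenvalues₀ j := by
        rw [norm_sq_eq_sum_slice X b χ]
        gcongr
    _ = _ := mul_comm _ _

/-- The bound of `SchmidtRankLE.norm_inner_sq_le` is attained by the truncation of `ψ` to its `j`
largest Schmidt coefficients. -/
theorem exists_schmidtRankLE_inner_eq (ψ : Hilb d) (j : ℕ) :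
    ∃ χ : Hilb d, SchmidtRankLE X b j χ ∧
      inner ℂ χ ψ = (partialSum (isHermitian_marginal X b ψ).eigenvalues₀ j : ℂ) ∧
      ‖χ‖ ^ 2 = partialSum (isHermitian_marginal X b ψ).eigenvalues₀ j := by
  set hψ := isHermitian_marginal X b ψ with hψ_def
  let F : Finset (Fin (Fintype.card (Idx (blockDim d X b)))) := {i | i.val < j}
  let c : ∀ z : (∀ i : {i : Fin n // ¬ X i = b}, Fin (d i)), Hilb (blockDim d X b) := fun z =>
    ∑ i ∈ F, (inner ℂ (eigvec hψ i) (slice X b ψ z) : ℂ) • eigvec hψ i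
  let e := Equiv.piEquivPiSubtypeProd (fun i => X i = b) (fun i => Fin (d i))
  let χ : Hilb d := WithLp.toLp 2 fun x => c (e x).2 (e x).1
  have hχ : ∀ z, slice X b χ z = c z := by
    intro z
    ext x
    change c (e (e.symm (x, z))).2 (e (e.symm (x, z))).1 = c z x
    rw [e.apply_symm_apply]
  have hsum : ∑ z, ∑ i ∈ F, ‖inner ℂ (eigvec hψ i) (slice X b ψ z)‖ ^ 2 =
      partialSum hψ.eigenvalues₀ j := by
    rw [Finset.sum_comm, partialSum, ← Finset.sum_filter]
    exact Finset.sum_congr rfl fun i _ => (eigenvalues₀_marginal X b ψ i).symm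
  have hinner : inner ℂ χ ψ = (partialSum hψ.eigenvalues₀ j : ℂ) := by
    rw [inner_eq_sum_slice X b, ← hsum]
    push_cast
    refine Finset.sum_congr rfl fun z _ => ?_
    rw [hχ, sum_inner]
    refine Finset.sum_congr rfl fun i _ => ?_
    rw [inner_smul_left, Complex.conj_mul']
  refine ⟨χ, ⟨Submodule.span ℂ (F.image (eigvec hψ)), ?_, fun z => ?_⟩, hinner, ?_⟩
  · refine (finrank_span_finset_le_card _).trans (Finset.card_image_le.trans ?_)
    rw [Fin.card_filter_val_lt]
    exact min_le_right _ _
  · rw [hχ]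
    exact Submodule.sum_mem _ fun i hi => Submodule.smul_mem _ _
      (Submodule.subset_span (Finset.mem_coe.mpr (Finset.mem_image_of_mem _ hi)))
  · rw [norm_sq_eq_sum_slice X b, ← hsum]
    refine Finset.sum_congr rfl fun z _ => ?_
    have hv : Orthonormal ℂ (eigvec hψ) := by
      have := (eigvecBasis hψ).orthonormal
      rwa [funext (eigvecBasis_apply hψ)] at this
    have h := hv.inner_sum (fun i => inner ℂ (eigvec hψ i) (slice X b ψ z))
      (fun i => inner ℂ (eigvec hψ i) (slice X b ψ z)) F
    simp only [Complex.conj_mul'] at h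
    rw [inner_self_eq_norm_sq_to_K] at h
    rw [hχ]
    refine Complex.ofReal_injective ?_
    push_cast
    exact h

/-- **Majorization.** If `ψ` can be transformed into `φ` by LOCC, then the spectrum of every
marginal of `ψ` is majorized by the spectrum of the corresponding marginal of `φ`. -/
theorem LOCCConvertible.partialSum_le {ψ φ : Hilb d} (hφ : ‖φ‖ = 1) (h : LOCCConvertible ψ φ)
    (X : Fin n → Fin k) (b : Fin k) (j : ℕ) :
    partialSum (isHermitian_marginal X b ψ).eigenvalues₀ j ≤
      partialSum (isHermitian_marginal X b φ).eigenvalues₀ j := by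
  obtain ⟨Φ, hΦ, hΦψ⟩ := h
  obtain ⟨T, _, K, hK, hKΦ⟩ := hΦ.exists_kraus
  rw [hKΦ] at hΦψ
  simp only [conj_pureState] at hΦψ
  obtain ⟨c, hc, hcK⟩ := exists_smul_eq_of_sum_pureState hφ hΦψ
  obtain ⟨χ, hχ, hχψ, hχn⟩ := exists_schmidtRankLE_inner_eq (X := X) (b := b) ψ j
  have h1 := norm_inner_sq_le_of_kraus hK hc hcK (χ := χ)
    fun t => (hχ.tensorOp (K t)).norm_inner_sq_le φ
  rw [hχψ, hχn, Complex.norm_real, Real.norm_eq_abs, sq_abs, sq] at h1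
  have h0 : ∀ ξ : Hilb d, 0 ≤ partialSum (isHermitian_marginal X b ξ).eigenvalues₀ j := fun ξ =>
    Finset.sum_nonneg fun i _ => by
      split_ifs
      exacts [eigenvalues₀_marginal_nonneg X b ξ i, le_rfl]
  rcases (h0 ψ).eq_or_lt with h2 | h2
  · rw [← h2]
    exact h0 φ
  · exact le_of_mul_le_mul_right h1 h2

end Schmidt

theorem LOCCConvertible.passiveEnergy_le {n k : ℕ} {d : Fin n → ℕ}
    {H : ∀ i, Matrix (Fin (d i)) (Fin (d i)) ℂ} (hH : ∀ i, (H i).IsHermitian) (X : Fin n → Fin k)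
    (b : Fin k) {ψ φ : Hilb d} (hψ : ‖ψ‖ = 1) (hφ : ‖φ‖ = 1) (h : LOCCConvertible ψ φ) :
    passiveEnergy hH X b φ ≤ passiveEnergy hH X b ψ := by
  simp only [passiveEnergy, energy_passiveState]
  refine sum_mul_le_sum_mul_of_majorized (fun i j hij => ?_) (h.partialSum_le hφ X b) ?_
  · exact (isHermitian_blockHamiltonian hH X b).eigenvalues₀_antitone (Fin.rev_le_rev.mpr hij)
  · rw [sum_eigenvalues₀_marginal, sum_eigenvalues₀_marginal, hψ, hφ]

/-! ### The global and the block-local minimum of the energy -/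

theorem iInf_energy_conj_pureState_eq {n : ℕ} {d : Fin n → ℕ} (H : Op d) {ψ φ : Hilb d}
    (hψ : ‖ψ‖ = 1) (hφ : ‖φ‖ = 1) :
    ⨅ U : Matrix.unitaryGroup (Idx d) ℂ, energy H ((U : Op d) * pureState ψ * (U : Op d)ᴴ) =
      ⨅ U : Matrix.unitaryGroup (Idx d) ℂ, energy H ((U : Op d) * pureState φ * (U : Op d)ᴴ) := by
  obtain ⟨V, hV⟩ := exists_unitary_mulVec_eq_of_norm hφ hψ
  rw [← (Equiv.mulRight V).iInf_comp (g := fun U : Matrix.unitaryGroup (Idx d) ℂ =>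
    energy H ((U : Op d) * pureState φ * (U : Op d)ᴴ))]
  refine iInf_congr fun U => ?_
  rw [← hV, ← conj_pureState]
  simp only [Equiv.coe_mulRight, Matrix.UnitaryGroup.mul_val, Matrix.conjTranspose_mul,
    Matrix.mul_assoc]

theorem iInf_energy_blockTensor_conj {n k : ℕ} {d : Fin n → ℕ}
    {H : ∀ i, Matrix (Fin (d i)) (Fin (d i)) ℂ} (hH : ∀ i, (H i).IsHermitian) (X : Fin n → Fin k)
    (ψ : Hilb d) :
    ⨅ U : (∀ b, Matrix.unitaryGroup (Idx (blockDim d X b)) ℂ),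
      energy (freeHamiltonian H)
        (blockTensor X (fun b => (U b : Op (blockDim d X b))) * pureState ψ *
          (blockTensor X (fun b => (U b : Op (blockDim d X b))))ᴴ) =
      ∑ b, passiveEnergy hH X b ψ := by
  have key : ∀ U : (∀ b, Matrix.unitaryGroup (Idx (blockDim d X b)) ℂ),
      energy (freeHamiltonian H)
        (blockTensor X (fun b => (U b : Op (blockDim d X b))) * pureState ψ *
          (blockTensor X (fun b => (U b : Op (blockDim d X b))))ᴴ) =
      ∑ b, energy (blockHamiltonian H X b) ((U b : Op (blockDim d X b)) *
        marginal X b (pureState ψ) * (U b : Op (blockDim d X b))ᴴ) := fun U =>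
    energy_blockTensor_conj X H _ (fun b => Matrix.mem_unitaryGroup_iff'.mp (U b).2) _
  have hmin := fun b => isLeast_energy_passiveState (isHermitian_blockHamiltonian hH X b)
    (isHermitian_marginal X b ψ)
  choose U hU using fun b => (hmin b).1
  refine IsLeast.csInf_eq ⟨⟨U, ?_⟩, ?_⟩
  · beta_reduce
    rw [key]
    exact Finset.sum_congr rfl fun b _ => hU b
  · rintro _ ⟨V, rfl⟩
    beta_reduce
    rw [key]
    exact Finset.sum_le_sum fun b _ => (hmin b).2 ⟨V b, rfl⟩

open scoped ComplexOrder MatrixOrder Matrix.Norms.L2Operator in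
/-- Local Hamiltonians with lowest eigenvalue `0` have a global ground state, of energy `0`, that
is a product of local ground states. -/
theorem iInf_energy_conj_pureState_eq_zero {n : ℕ} {d : Fin n → ℕ}
    {H : ∀ i, Matrix (Fin (d i)) (Fin (d i)) ℂ} (hH : ∀ i, (H i).IsHermitian)
    (h0 : ∀ i, IsLeast (spectrum ℝ (H i)) 0) {ψ : Hilb d} (hψ : ‖ψ‖ = 1) :
    ⨅ U : Matrix.unitaryGroup (Idx d) ℂ,
      energy (freeHamiltonian H) ((U : Op d) * pureState ψ * (U : Op d)ᴴ) = 0 := by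
  have hpos : ∀ i, (H i).PosSemidef := by
    intro i
    rw [(hH i).posSemidef_iff_eigenvalues_nonneg]
    exact fun j => (h0 i).2 ((hH i).eigenvalues_mem_spectrum_real j)
  have henergy : ∀ χ : Hilb d, energy (freeHamiltonian H) (pureState χ) =
      ∑ i, (star χ.ofLp ⬝ᵥ (tensorOp (Function.update
        (fun j => (1 : Matrix (Fin (d j)) (Fin (d j)) ℂ)) i (H i)) *ᵥ χ.ofLp)).re := by
    intro χ
    have hp : pureState χ = Matrix.vecMulVec χ.ofLp (star χ.ofLp) := rfl
    rw [energy, hp, Matrix.vecMulVec_mul, Matrix.trace_vecMulVec, ← dotProduct_comm,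
      ← Matrix.dotProduct_mulVec, freeHamiltonian, Matrix.sum_mulVec, dotProduct_sum,
      Complex.re_sum]
  have hpsd : ∀ i, (tensorOp (Function.update
      (fun j => (1 : Matrix (Fin (d j)) (Fin (d j)) ℂ)) i (H i))).PosSemidef := by
    intro i
    -- A factorization `H i = Bᴴ * B` survives the tensor product with identities.
    obtain ⟨B, hB⟩ := CStarAlgebra.nonneg_iff_eq_star_mul_self.mp (hpos i).nonneg
    have : tensorOp (Function.update
        (fun j => (1 : Matrix (Fin (d j)) (Fin (d j)) ℂ)) i (H i)) =
        (tensorOp (Function.update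
          (fun j => (1 : Matrix (Fin (d j)) (Fin (d j)) ℂ)) i B))ᴴ *
        tensorOp (Function.update
          (fun j => (1 : Matrix (Fin (d j)) (Fin (d j)) ℂ)) i B) := by
      rw [conjTranspose_tensorOp, tensorOp_mul]
      congr 1
      funext j
      rcases eq_or_ne j i with rfl | hj
      · simp [hB, Matrix.star_eq_conjTranspose]
      · simp [Function.update_of_ne hj]
    rw [this]
    exact Matrix.posSemidef_conjTranspose_mul_self _
  have hground : ∀ i, ∃ v : EuclideanSpace ℂ (Fin (d i)), ‖v‖ = 1 ∧ H i *ᵥ v.ofLp = 0 := by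
    intro i
    have := (h0 i).1
    rw [(hH i).spectrum_real_eq_range_eigenvalues] at this
    obtain ⟨j, hj⟩ := this
    refine ⟨(hH i).eigenvectorBasis j, (hH i).eigenvectorBasis.orthonormal.1 j, ?_⟩
    rw [(hH i).mulVec_eigenvectorBasis, hj, zero_smul]
  choose v hv1 hv0 using hground
  let χ : Hilb d := WithLp.toLp 2 fun x => ∏ i, v i (x i)
  have hχ1 : ‖χ‖ = 1 := by
    have h2 : ‖χ‖ ^ 2 = 1 := by
      rw [EuclideanSpace.norm_sq_eq]
      simp only [χ, norm_prod, ← Finset.prod_pow]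
      rw [← Fintype.prod_sum (fun i a => ‖v i a‖ ^ 2)]
      simp only [← EuclideanSpace.norm_sq_eq, hv1, one_pow, Finset.prod_const_one]
    exact (pow_eq_one_iff_of_nonneg (norm_nonneg _) two_ne_zero).mp h2
  have hχ0 : energy (freeHamiltonian H) (pureState χ) = 0 := by
    rw [henergy]
    refine Finset.sum_eq_zero fun i _ => ?_
    have : tensorOp (Function.update
        (fun j => (1 : Matrix (Fin (d j)) (Fin (d j)) ℂ)) i (H i)) *ᵥ χ.ofLp = 0 := by
      simp only [χ]
      rw [tensorOp_mulVec_prod _ fun i => (v i).ofLp]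
      funext x
      refine Finset.prod_eq_zero (Finset.mem_univ i) ?_
      rw [Function.update_self, hv0]
      rfl
    rw [this, dotProduct_zero, Complex.zero_re]
  rw [iInf_energy_conj_pureState_eq _ hψ hχ1]
  refine IsLeast.csInf_eq ⟨⟨1, by simpa using hχ0⟩, ?_⟩
  rintro _ ⟨U, rfl⟩
  beta_reduce
  rw [conj_pureState, henergy]
  exact Finset.sum_nonneg fun i _ => (hpsd i).re_dotProduct_nonneg _

end Ergo

end

theorem theorem2 {n k : ℕ} (d : Fin n → ℕ)
    (H : ∀ i, Matrix (Fin (d i)) (Fin (d i)) ℂ) (hH : ∀ i, (H i).IsHermitian)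
    (X : Fin n → Fin k) (hX : Function.Surjective X) :
    (∀ ψ φ : Ergo.Hilb d, ‖ψ‖ = 1 → ‖φ‖ = 1 → Ergo.LOCCConvertible ψ φ →
      Ergo.ergotropicGap H X φ ≤ Ergo.ergotropicGap H X ψ) ∧
    ((∀ i, IsLeast (spectrum ℝ (H i)) 0) →
      ∀ ψ : Ergo.Hilb d, ‖ψ‖ = 1 →
        Ergo.ergotropicGap H X ψ = ∑ b, Ergo.passiveEnergy hH X b ψ) := by
  have hgap : ∀ ψ : Ergo.Hilb d, Ergo.ergotropicGap H X ψ = ∑ b, Ergo.passiveEnergy hH X b ψ -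
      ⨅ U : Matrix.unitaryGroup (Ergo.Idx d) ℂ, Ergo.energy (Ergo.freeHamiltonian H)
        ((U : Ergo.Op d) * Ergo.pureState ψ * (U : Ergo.Op d).conjTranspose) := by
    intro ψ
    rw [Ergo.ergotropicGap, Ergo.globalErgotropy, Ergo.blockErgotropy,
      Ergo.iInf_energy_blockTensor_conj hH X ψ]
    ring
  refine ⟨fun ψ φ hψ hφ h => ?_, fun h0 ψ hψ => ?_⟩
  · rw [hgap, hgap, Ergo.iInf_energy_conj_pureState_eq _ hψ hφ]
    exact sub_le_sub_right (Finset.sum_le_sum fun b _ => h.passiveEnergy_le hH X b hψ hφ) _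
  · rw [hgap, Ergo.iInf_energy_conj_pureState_eq_zero hH h0 hψ, sub_zero]
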